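/- **Corollary (Cartesian product of sets).** There is an absolute constant $c_0>0$ such that for every $c\ge c_0$ there are constants $0<a\le A<\infty$, depending only on $c$, for which the following holds. Let $m,n\ge 0$ be integers, let $K_1\subset\mathbb{R}^m$ and $K_2\subset\mathbb{R}^n$ be closed, bounded and convex, put $K=K_1\times K_2\subset\mathbb{R}^{m+n}$, and let $\sigma>0$. Consider the Gaussian sequence model $Y=\mu+\xi$, where $\mu\in K$ and the $m+n$ coordinates of $\xi$ are i.i.d. $N(0,\sigma^2)$. Let $\|\cdot\|$ be the Euclidean norm and let $B(\theta,\varepsilon)$ denote closed Euclidean balls. For $i=1,2$ and $\varepsilon\ge 0$ let $$M^{\mathrm{loc}}_{K_i}(\varepsilon)=\sup_{\theta\in K_i}M\big(\varepsilon/c,\;B(\theta,\varepsilon)\cap K_i\big),$$ where $M(\delta,S)$ is the largest cardinality of a $\delta$-packing of $S$, that is, of a subset of $S$ whose distinct points are at distance greater than $\delta$. Let $$\varepsilon^*=\sup\Big\{\varepsilon\ge 0:\ \frac{\varepsilon^2}{\sigma^2}\le \log M^{\mathrm{loc}}_{K_1}(\varepsilon)\vee\log M^{\mathrm{loc}}_{K_2}(\varepsilon)\Big\}.$$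 Then $$a\,\big(\varepsilon^{*2}\wedge\operatorname{diam}(K)^2\big)\ \le\ \inf_{\hat\nu}\ \sup_{\mu\in K}\ \mathbb{E}_\mu\|\hat\nu(Y)-\mu\|^2\ \le\ A\,\big(\varepsilon^{*2}\wedge\operatorname{diam}(K)^2\big),$$ where the infimum is over all measurable estimators $\hat\nu:\mathbb{R}^{m+n}\to\mathbb{R}^{m+n}$. -/

import Mathlib

open MeasureTheory ProbabilityTheory
open scoped NNReal ENNReal

namespace GaussianSequence

/-- The law of the observation `Y = μ + ξ` on `ℝⁿ` with its Euclidean norm, where the coordinates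
`ξ i` are independent with law `N(0, σ²)`. -/
noncomputable def observationLaw {n : ℕ} (σ : ℝ) (μ : EuclideanSpace ℝ (Fin n)) :
    Measure (EuclideanSpace ℝ (Fin n)) :=
  (Measure.pi fun i => gaussianReal (μ i) (σ ^ 2).toNNReal).map (WithLp.toLp 2)

/-- The minimax risk `inf_ν sup_{μ ∈ K} E ‖ν(Y) - μ‖²`; the infimum is over all measurable
estimators `ν`, which may take values outside `K`. -/
noncomputable def minimaxRisk {n : ℕ} (σ : ℝ) (K : Set (EuclideanSpace ℝ (Fin n))) : ℝ≥0∞ :=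
  ⨅ (ν : EuclideanSpace ℝ (Fin n) → EuclideanSpace ℝ (Fin n)) (_ : Measurable ν),
    ⨆ μ ∈ K, ∫⁻ y, ‖ν y - μ‖ₑ ^ 2 ∂(observationLaw σ μ)

/-- `M^loc_K(ε) = sup_{θ ∈ K} M(ε/c, B(θ, ε) ∩ K)`, where `B` is a closed ball and `M(δ, S)` is the
largest cardinality of a subset of `S` whose distinct points are at distance `> δ`. -/
noncomputable def localPackingNumber {n : ℕ} (c : ℝ≥0) (K : Set (EuclideanSpace ℝ (Fin n)))
    (ε : ℝ≥0) : ℕ∞ :=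
  ⨆ θ ∈ K, Metric.packingNumber (ε / c) (Metric.closedBall θ (ε : ℝ) ∩ K)

/-- The local entropy `log M^loc_K(ε)`, with `log 0 = -∞` and `log ∞ = ∞`. -/
noncomputable def localEntropy {n : ℕ} (c : ℝ≥0) (K : Set (EuclideanSpace ℝ (Fin n)))
    (ε : ℝ≥0) : EReal :=
  ENNReal.log (localPackingNumber c K ε : ℝ≥0∞)

/-- `ε* = sup {ε ≥ 0 : ε² / σ² ≤ H(ε)}` in `[0, ∞]`. -/
noncomputable def criticalRadius (σ : ℝ) (H : ℝ≥0 → EReal) : ℝ≥0∞ :=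
  sSup {r : ℝ≥0∞ | ∃ ε : ℝ≥0, r = (ε : ℝ≥0∞) ∧ (((ε : ℝ) ^ 2 / σ ^ 2 : ℝ) : EReal) ≤ H ε}

/-- The Cartesian product `K₁ × K₂` as a subset of `ℝ^(m + n)`: the first `m` coordinates form a
point of `K₁` and the last `n` coordinates a point of `K₂`. -/
def cartesianProduct {m n : ℕ} (K₁ : Set (EuclideanSpace ℝ (Fin m)))
    (K₂ : Set (EuclideanSpace ℝ (Fin n))) : Set (EuclideanSpace ℝ (Fin (m + n))) :=
  {x | WithLp.toLp 2 (fun i : Fin m => x (Fin.castAdd n i)) ∈ K₁ ∧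
    WithLp.toLp 2 (fun j : Fin n => x (Fin.natAdd m j)) ∈ K₂}

end GaussianSequence

/-! Only the factors carry entropy conditions, so everything reduces to one convex set in each
factor, plus the additivity of squared loss.

Lower bound. Freezing one component embeds the other factor isometrically in `K`, so a packing of
`K₁` or `K₂` is a testing problem for `K`. If its `N` points lie within `ρ` of a common centre and
`N ≥ exp (2ρ²/σ²)`, no estimator can identify them reliably (`le_minimaxRisk_of_separated`).
Convexity makes local packing numbers decrease with the radius (`localPackingNumber_antitone`). A
packing at radius `ε/2` thus keeps the entropy available at `ε`, and the slack pays for the constant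
in the exponent.

Upper bound. The estimator is the nearest point of a maximal `ε/c`-separated subset of a factor. A
net point at distance `D` from the one near `μ` is preferred with probability at most `exp
(-D²/(32σ²))`. Since local entropy decreases, iterated covering gives at most `exp ((j+1)ε²/σ²)` net
points within `c^j (ε/c)`, and the Gaussian tail wins on every distant shell (`sum_sq_mul_exp_le`).
Just above the critical radius this gives risk of order `ε*²`; if the diameter is at most twice that
radius, a constant estimator suffices.

The estimators of the two factors are run on the two blocks of `Y` and their risks add. Each factor
has critical radius at most `ε*` and diameter at most that of `K`. -/

namespace GaussianSequence

/-! ### Change of measure for Gaussian translates -/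

theorem gaussianReal_add_eq_withDensity (m h : ℝ) {v : ℝ≥0} (hv : v ≠ 0) :
    gaussianReal (m + h) v =
      (gaussianReal m v).withDensity
        fun x => ENNReal.ofReal (Real.exp (((x - m) * h - h ^ 2 / 2) / v)) := by
  have hv' : (v : ℝ) ≠ 0 := by exact_mod_cast hv
  rw [gaussianReal_of_var_ne_zero _ hv, gaussianReal_of_var_ne_zero _ hv,
    ← withDensity_mul _ (measurable_gaussianPDF m v) (by fun_prop)]
  congr 1
  ext x
  simp only [Pi.mul_apply, gaussianPDF]
  rw [← ENNReal.ofReal_mul (gaussianPDFReal_nonneg _ _ _)]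
  simp only [gaussianPDFReal]
  rw [mul_assoc _ (Real.exp _), ← Real.exp_add]
  congr 3
  field_simp
  ring

/-- On a box the restricted density is a product of functions of single coordinates, so independence
factorises its integral. -/
theorem pi_withDensity {ι : Type*} [Fintype ι] {Ω : ι → Type*} [∀ i, MeasurableSpace (Ω i)]
    (ν : ∀ i, Measure (Ω i)) [∀ i, IsProbabilityMeasure (ν i)] (g : ∀ i, Ω i → ℝ≥0∞)
    (hg : ∀ i, Measurable (g i)) [∀ i, SigmaFinite ((ν i).withDensity (g i))] :
    Measure.pi (fun i => (ν i).withDensity (g i)) =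
      (Measure.pi ν).withDensity fun x => ∏ i, g i (x i) := by
  refine Measure.pi_eq fun s hs => ?_
  rw [withDensity_apply _ (MeasurableSet.univ_pi hs),
    ← lintegral_indicator (MeasurableSet.univ_pi hs)]
  have hind : ∀ x : ∀ i, Ω i, (Set.univ.pi s).indicator (fun x => ∏ i, g i (x i)) x =
      ∏ i, (s i).indicator (g i) (x i) := by
    intro x
    by_cases hx : x ∈ Set.univ.pi s
    · rw [Set.indicator_of_mem hx]
      exact Finset.prod_congr rfl fun i _ => (Set.indicator_of_mem (hx i trivial) _).symm
    · rw [Set.indicator_of_notMem hx]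
      simp only [Set.mem_pi, Set.mem_univ, true_implies, not_forall] at hx
      obtain ⟨i, hi⟩ := hx
      exact (Finset.prod_eq_zero (Finset.mem_univ i) (Set.indicator_of_notMem hi _)).symm
  have hm : ∀ i, Measurable ((s i).indicator (g i)) := fun i => (hg i).indicator (hs i)
  simp_rw [hind]
  rw [lintegral_prod_eq_prod_lintegral_of_indepFun Finset.univ
    (fun i (x : ∀ i, Ω i) => (s i).indicator (g i) (x i))
    (iIndepFun_pi fun i => (hm i).aemeasurable) (fun i => (hm i).comp (measurable_pi_apply i))]
  refine Finset.prod_congr rfl fun i _ => ?_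
  rw [(measurePreserving_eval ν i).lintegral_comp (hm i), lintegral_indicator (hs i),
    withDensity_apply _ (hs i)]

variable {n : ℕ} {σ : ℝ}

instance (σ : ℝ) (μ : EuclideanSpace ℝ (Fin n)) : IsProbabilityMeasure (observationLaw σ μ) :=
  Measure.isProbabilityMeasure_map (WithLp.measurable_toLp 2 _).aemeasurable

theorem observationLaw_add (hσ : 0 < σ) (μ h : EuclideanSpace ℝ (Fin n)) :
    observationLaw σ (μ + h) = (observationLaw σ μ).withDensity fun y =>
      ENNReal.ofReal (Real.exp ((inner ℝ (y - μ) h - ‖h‖ ^ 2 / 2) / σ ^ 2)) := by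
  have hv : (σ ^ 2).toNNReal ≠ 0 := by
    simp only [ne_eq, Real.toNNReal_eq_zero, not_le]; positivity
  have hvσ : ((σ ^ 2).toNNReal : ℝ) = σ ^ 2 := Real.coe_toNNReal _ (by positivity)
  have hpi : Measure.pi (fun i => gaussianReal ((μ + h) i) (σ ^ 2).toNNReal) =
      (Measure.pi fun i => gaussianReal (μ i) (σ ^ 2).toNNReal).withDensity fun x =>
        ∏ i, ENNReal.ofReal (Real.exp (((x i - μ i) * h i - h i ^ 2 / 2) / σ ^ 2)) := by
    have key : ∀ i, gaussianReal ((μ + h) i) (σ ^ 2).toNNReal =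
        (gaussianReal (μ i) (σ ^ 2).toNNReal).withDensity fun x =>
          ENNReal.ofReal (Real.exp (((x - μ i) * h i - h i ^ 2 / 2) / σ ^ 2)) := by
      intro i
      rw [PiLp.add_apply, gaussianReal_add_eq_withDensity _ _ hv, hvσ]
    have : ∀ i, SigmaFinite ((gaussianReal (μ i) (σ ^ 2).toNNReal).withDensity fun x =>
          ENNReal.ofReal (Real.exp (((x - μ i) * h i - h i ^ 2 / 2) / σ ^ 2))) := by
      intro i; rw [← key i]; infer_instance
    simp_rw [key]
    exact pi_withDensity (fun i => gaussianReal (μ i) (σ ^ 2).toNNReal)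
      (fun i x => ENNReal.ofReal (Real.exp (((x - μ i) * h i - h i ^ 2 / 2) / σ ^ 2)))
      (fun i => by fun_prop)
  have hprod : ∀ x : Fin n → ℝ,
      ∏ i, ENNReal.ofReal (Real.exp (((x i - μ i) * h i - h i ^ 2 / 2) / σ ^ 2)) =
      ENNReal.ofReal (Real.exp ((inner ℝ (WithLp.toLp 2 x - μ) h - ‖h‖ ^ 2 / 2) / σ ^ 2)) := by
    intro x
    rw [← ENNReal.ofReal_prod_of_nonneg (fun i _ => (Real.exp_pos _).le), ← Real.exp_sum,
      ← Finset.sum_div, Finset.sum_sub_distrib, ← Finset.sum_div, EuclideanSpace.real_norm_sq_eq,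
      PiLp.inner_apply]
    congr 6
    ext i
    simp [mul_comm]
  simp_rw [hprod] at hpi
  have hT := WithLp.measurable_toLp 2 (Fin n → ℝ)
  ext A hA
  rw [observationLaw, hpi, Measure.map_apply hT hA, withDensity_apply _ (hT hA),
    withDensity_apply _ hA, observationLaw, setLIntegral_map hA (by fun_prop) hT]

/-- Chernoff bound for a linear functional of the noise. -/
theorem observationLaw_le_inner (hσ : 0 < σ) (μ h : EuclideanSpace ℝ (Fin n)) (t : ℝ) :
    observationLaw σ μ {y | t ≤ inner ℝ (y - μ) h} ≤
      ENNReal.ofReal (Real.exp (-((t - ‖h‖ ^ 2 / 2) / σ ^ 2))) := by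
  set A : Set (EuclideanSpace ℝ (Fin n)) := {y | t ≤ inner ℝ (y - μ) h}
  have hA : MeasurableSet A := measurableSet_le measurable_const (by fun_prop)
  have h1 : ENNReal.ofReal (Real.exp ((t - ‖h‖ ^ 2 / 2) / σ ^ 2)) * observationLaw σ μ A ≤ 1 := by
    calc _ = ∫⁻ _ in A, ENNReal.ofReal (Real.exp ((t - ‖h‖ ^ 2 / 2) / σ ^ 2))
            ∂(observationLaw σ μ) := by rw [setLIntegral_const]
      _ ≤ ∫⁻ y in A, ENNReal.ofReal (Real.exp ((inner ℝ (y - μ) h - ‖h‖ ^ 2 / 2) / σ ^ 2))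
            ∂(observationLaw σ μ) := by
          refine setLIntegral_mono (by fun_prop) fun y hy => ?_
          have : t ≤ inner ℝ (y - μ) h := hy
          gcongr
      _ = observationLaw σ (μ + h) A := by rw [observationLaw_add hσ, withDensity_apply _ hA]
      _ ≤ 1 := prob_le_one
  rw [Real.exp_neg, ENNReal.ofReal_inv_of_pos (Real.exp_pos _)]
  exact (ENNReal.le_inv_iff_mul_le.2 (by rwa [mul_comm]))

/-- If `a` is the density of the law at `μ + h` with respect to that at `μ`, then `a²` is `exp
(‖h‖²/σ²)` times the density at `μ + 2h`. Integrate `a ≤ t/2 + a²/(2t)` over `A` and bound the mass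
at `μ + 2h` by `1`. -/
theorem observationLaw_le_add (hσ : 0 < σ) (μ h : EuclideanSpace ℝ (Fin n)) {t : ℝ} (ht : 0 < t)
    {A : Set (EuclideanSpace ℝ (Fin n))} (hA : MeasurableSet A) :
    observationLaw σ (μ + h) A ≤ ENNReal.ofReal (t / 2) * observationLaw σ μ A +
      ENNReal.ofReal (Real.exp (‖h‖ ^ 2 / σ ^ 2) / (2 * t)) := by
  have h2 : observationLaw σ (μ + (2 : ℝ) • h) A ≤ 1 := prob_le_one
  rw [observationLaw_add hσ, withDensity_apply _ hA] at h2
  rw [observationLaw_add hσ, withDensity_apply _ hA]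
  calc _ ≤ ∫⁻ y in A, (ENNReal.ofReal (t / 2) +
          ENNReal.ofReal (Real.exp (‖h‖ ^ 2 / σ ^ 2) / (2 * t)) * ENNReal.ofReal (Real.exp
            ((inner ℝ (y - μ) ((2 : ℝ) • h) - ‖(2 : ℝ) • h‖ ^ 2 / 2) / σ ^ 2)))
            ∂(observationLaw σ μ) := by
        refine setLIntegral_mono (by fun_prop) fun y _ => ?_
        rw [← ENNReal.ofReal_mul (by positivity), ← ENNReal.ofReal_add (by positivity)
          (by positivity)]
        apply ENNReal.ofReal_le_ofReal
        rw [div_mul_eq_mul_div, ← Real.exp_add]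
        set a := Real.exp ((inner ℝ (y - μ) h - ‖h‖ ^ 2 / 2) / σ ^ 2)
        have : Real.exp (‖h‖ ^ 2 / σ ^ 2 +
            (inner ℝ (y - μ) ((2 : ℝ) • h) - ‖(2 : ℝ) • h‖ ^ 2 / 2) / σ ^ 2) = a ^ 2 := by
          rw [← Real.exp_nat_mul]
          congr 1
          rw [inner_smul_right, norm_smul]
          simp only [Real.norm_ofNat, Nat.cast_ofNat]
          ring
        rw [this, ← sub_nonneg]
        have : t / 2 + a ^ 2 / (2 * t) - a = (t - a) ^ 2 / (2 * t) := by field_simp; ring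
        rw [this]
        positivity
    _ = ENNReal.ofReal (t / 2) * observationLaw σ μ A +
          ENNReal.ofReal (Real.exp (‖h‖ ^ 2 / σ ^ 2) / (2 * t)) * ∫⁻ y in A, ENNReal.ofReal
          (Real.exp ((inner ℝ (y - μ) ((2 : ℝ) • h) - ‖(2 : ℝ) • h‖ ^ 2 / 2) / σ ^ 2))
            ∂(observationLaw σ μ) := by
        rw [lintegral_add_left measurable_const, setLIntegral_const,
          lintegral_const_mul _ (by fun_prop)]
    _ ≤ _ := by
        gcongr
        exact mul_le_of_le_one_right' h2

/-! ### Monotonicity of local packing numbers -/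

/-- The homothety of centre `θ` and ratio `ε'/ε` keeps `K` inside itself by convexity, and scales
both the ball and the separation by the same factor. -/
theorem packingNumber_closedBall_inter_antitone {K : Set (EuclideanSpace ℝ (Fin n))}
    (hK : Convex ℝ K) {θ : EuclideanSpace ℝ (Fin n)} (hθ : θ ∈ K) (c : ℝ≥0) {ε ε' : ℝ≥0}
    (h0 : 0 < ε') (h : ε' ≤ ε) :
    Metric.packingNumber (ε / c) (Metric.closedBall θ (ε : ℝ) ∩ K) ≤
      Metric.packingNumber (ε' / c) (Metric.closedBall θ (ε' : ℝ) ∩ K) := by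
  have hε : 0 < ε := h0.trans_le h
  have hεr : (0 : ℝ) < ε := by exact_mod_cast hε
  have h0r : (0 : ℝ) < ε' := by exact_mod_cast h0
  have hr : (ε' : ℝ) ≤ ε := by exact_mod_cast h
  set t : ℝ := ε' / ε
  have ht0 : 0 < t := by positivity
  have ht1 : t ≤ 1 := (div_le_one hεr).2 hr
  have hdist : ∀ x y, dist (AffineMap.homothety θ t x) (AffineMap.homothety θ t y) =
      t * dist x y := by
    intro x y
    simp only [AffineMap.homothety_apply, vsub_eq_sub, vadd_eq_add, dist_add_right, dist_smul₀,
      Real.norm_of_nonneg ht0.le, dist_sub_right]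
  have hinj : Function.Injective (AffineMap.homothety θ t : _ → EuclideanSpace ℝ (Fin n)) := by
    intro x y hxy
    have := hdist x y
    rw [hxy, dist_self] at this
    exact dist_eq_zero.1 ((mul_eq_zero.1 this.symm).resolve_left ht0.ne')
  refine iSup_le fun C => iSup_le fun hC => iSup_le fun hsep => ?_
  rw [← hinj.encard_image C]
  refine Metric.IsSeparated.encard_le_packingNumber ?_ ?_
  · rintro _ ⟨x, hx, rfl⟩
    refine ⟨?_, ?_⟩
    · have h1 := hdist x θ
      rw [AffineMap.homothety_apply_same] at h1
      rw [Metric.mem_closedBall, h1]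
      have h2 : dist x θ ≤ ε := (hC hx).1
      calc t * dist x θ ≤ t * ε := by gcongr
        _ = ε' := by simp only [t]; field_simp
    · have := hK.lineMap_mem hθ (hC hx).2 ⟨ht0.le, ht1⟩
      rwa [AffineMap.homothety_eq_lineMap]
  · rintro _ ⟨x, hx, rfl⟩ _ ⟨y, hy, rfl⟩ hxy
    have h1 : (↑(ε / c) : ℝ≥0∞) < edist x y := hsep hx hy (fun h => hxy (by rw [h]))
    change (↑(ε' / c) : ℝ≥0∞) < edist _ _
    rw [edist_nndist, ENNReal.coe_lt_coe, ← NNReal.coe_lt_coe, coe_nndist] at h1 ⊢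
    rw [hdist]
    calc ((ε' / c : ℝ≥0) : ℝ) = t * ((ε / c : ℝ≥0) : ℝ) := by
          push_cast; simp only [t]; field_simp
      _ < t * dist x y := by gcongr

theorem localPackingNumber_antitone {K : Set (EuclideanSpace ℝ (Fin n))}
    (hK : Convex ℝ K) (c : ℝ≥0) {ε ε' : ℝ≥0} (h0 : 0 < ε') (h : ε' ≤ ε) :
    localPackingNumber c K ε ≤ localPackingNumber c K ε' :=
  iSup₂_mono fun _ hθ => packingNumber_closedBall_inter_antitone hK hθ c h0 h

/-! ### Lower bound by multiple testing -/

/-- The events that `ν` lands within `δ/2` of a given point are disjoint, so their probabilities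
under the single law at `θ` sum to at most `1`. Changing measure with `t = N`, the number of points,
shows that the average success probability is at most `7/8`. Each failure costs at least `δ²/4`,
whence `δ²/32`. -/
theorem le_minimaxRisk_of_separated (hσ : 0 < σ) {K : Set (EuclideanSpace ℝ (Fin n))}
    {T : Finset (EuclideanSpace ℝ (Fin n))} (hTK : ∀ s ∈ T, s ∈ K) {δ ρ : ℝ} (hδ : 0 ≤ δ)
    (hsep : ∀ s ∈ T, ∀ s' ∈ T, s ≠ s' → δ < dist s s') {θ : EuclideanSpace ℝ (Fin n)}
    (hθ : ∀ s ∈ T, dist s θ ≤ ρ) (hcard : 2 ≤ T.card)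
    (hexp : Real.exp (ρ ^ 2 / σ ^ 2) ^ 2 ≤ T.card) :
    ENNReal.ofReal (δ ^ 2 / 32) ≤ minimaxRisk σ K := by
  refine le_iInf₂ fun ν hν => ?_
  set R := ⨆ μ ∈ K, ∫⁻ y, ‖ν y - μ‖ₑ ^ 2 ∂(observationLaw σ μ)
  have hN2 : (2 : ℝ) ≤ T.card := by exact_mod_cast hcard
  have hN : (0 : ℝ) < T.card := by linarith
  let A : EuclideanSpace ℝ (Fin n) → Set (EuclideanSpace ℝ (Fin n)) :=
    fun s => {y | ‖ν y - s‖ ≤ δ / 2}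
  have hA : ∀ s, MeasurableSet (A s) := fun s => measurableSet_le (by fun_prop) measurable_const
  have hdisj : Set.PairwiseDisjoint (T : Set (EuclideanSpace ℝ (Fin n))) A := by
    intro s hs s' hs' hne
    refine Set.disjoint_left.2 fun y hy hy' => ?_
    have h1 : ‖ν y - s‖ ≤ δ / 2 := hy
    have h2 : ‖ν y - s'‖ ≤ δ / 2 := hy'
    have h3 := hsep s hs s' hs' hne
    rw [← dist_eq_norm] at h1 h2
    have h4 := dist_triangle_left s s' (ν y)
    linarith
  have hrisk : ∀ s ∈ T, ENNReal.ofReal (δ ^ 2 / 4) * observationLaw σ s (A s)ᶜ ≤ R := by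
    intro s hs
    calc _ ≤ ENNReal.ofReal (δ ^ 2 / 4) * observationLaw σ s
            {y | ENNReal.ofReal (δ ^ 2 / 4) ≤ ‖ν y - s‖ₑ ^ 2} := by
          gcongr
          intro y hy
          have h1 : δ / 2 < ‖ν y - s‖ := not_le.1 hy
          have : δ ^ 2 / 4 = (δ / 2) ^ 2 := by ring
          rw [Set.mem_ofPred_eq, this, ENNReal.ofReal_pow (by positivity), ← ofReal_norm]
          gcongr
      _ ≤ ∫⁻ y, ‖ν y - s‖ₑ ^ 2 ∂(observationLaw σ s) :=
          mul_meas_ge_le_lintegral (by fun_prop) _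
      _ ≤ R := le_iSup₂_of_le s (hTK s hs) le_rfl
  have hsucc : ∑ s ∈ T, observationLaw σ s (A s) ≤ ENNReal.ofReal (7 / 8 * T.card) := by
    calc ∑ s ∈ T, observationLaw σ s (A s)
        ≤ ∑ s ∈ T, (ENNReal.ofReal (T.card / 2) * observationLaw σ θ (A s) +
            ENNReal.ofReal (Real.exp (ρ ^ 2 / σ ^ 2) / (2 * T.card))) := by
          refine Finset.sum_le_sum fun s hs => ?_
          have h1 := observationLaw_le_add hσ θ (s - θ) hN (hA s)
          rw [add_sub_cancel] at h1
          refine h1.trans ?_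
          have := hθ s hs
          rw [dist_eq_norm] at this
          gcongr
      _ = ENNReal.ofReal (T.card / 2) * ∑ s ∈ T, observationLaw σ θ (A s) +
            T.card * ENNReal.ofReal (Real.exp (ρ ^ 2 / σ ^ 2) / (2 * T.card)) := by
          rw [Finset.sum_add_distrib, Finset.mul_sum, Finset.sum_const, nsmul_eq_mul]
      _ ≤ ENNReal.ofReal (T.card / 2) * 1 +
            T.card * ENNReal.ofReal (Real.exp (ρ ^ 2 / σ ^ 2) / (2 * T.card)) := by
          gcongr
          rw [← measure_biUnion_finset hdisj fun s _ => hA s]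
          exact prob_le_one
      _ ≤ ENNReal.ofReal (7 / 8 * T.card) := by
          rw [mul_one, ← ENNReal.ofReal_natCast, ← ENNReal.ofReal_mul (by positivity),
            ← ENNReal.ofReal_add (by positivity) (by positivity)]
          apply ENNReal.ofReal_le_ofReal
          -- The square of the left side is at most `N`, and `N ≤ (9/16) N²` because `N ≥ 2`.
          have h1 : Real.exp (ρ ^ 2 / σ ^ 2) ≤ 3 / 4 * T.card := by
            refine le_of_sq_le_sq ?_ (by positivity)
            nlinarith
          have h2 : (T.card : ℝ) * (Real.exp (ρ ^ 2 / σ ^ 2) / (2 * T.card)) =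
              Real.exp (ρ ^ 2 / σ ^ 2) / 2 := by field_simp
          rw [h2]
          linarith
  have hfail : ENNReal.ofReal (T.card / 8) ≤ ∑ s ∈ T, observationLaw σ s (A s)ᶜ := by
    have h1 : ENNReal.ofReal (T.card / 8) + ENNReal.ofReal (7 / 8 * T.card) ≤
        ∑ s ∈ T, observationLaw σ s (A s)ᶜ + ENNReal.ofReal (7 / 8 * T.card) := by
      calc _ = ∑ s ∈ T, (observationLaw σ s (A s)ᶜ + observationLaw σ s (A s)) := by
            simp_rw [add_comm (observationLaw σ _ (A _)ᶜ), measure_add_measure_compl (hA _),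
              measure_univ]
            rw [← ENNReal.ofReal_add (by positivity) (by positivity), Finset.sum_const,
              nsmul_eq_mul, mul_one, ← ENNReal.ofReal_natCast]
            congr 1
            ring
        _ ≤ _ := by rw [Finset.sum_add_distrib]; gcongr
    exact (ENNReal.add_le_add_iff_right ENNReal.ofReal_ne_top).1 h1
  have htot : (T.card : ℝ≥0∞) * ENNReal.ofReal (δ ^ 2 / 32) ≤ T.card * R := by
    calc (T.card : ℝ≥0∞) * ENNReal.ofReal (δ ^ 2 / 32)
        = ENNReal.ofReal (δ ^ 2 / 4) * ENNReal.ofReal (T.card / 8) := by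
          rw [← ENNReal.ofReal_natCast, ← ENNReal.ofReal_mul (by positivity),
            ← ENNReal.ofReal_mul (by positivity)]
          congr 1
          ring
      _ ≤ ENNReal.ofReal (δ ^ 2 / 4) * ∑ s ∈ T, observationLaw σ s (A s)ᶜ := by gcongr
      _ ≤ ∑ s ∈ T, R := by rw [Finset.mul_sum]; exact Finset.sum_le_sum hrisk
      _ = T.card * R := by rw [Finset.sum_const, nsmul_eq_mul]
  exact (ENNReal.mul_le_mul_iff_right (by exact_mod_cast (by omega : T.card ≠ 0))
    (ENNReal.natCast_ne_top _)).1 htot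

/-- The packing is taken at radius `ρ = ε/2`, where `2ρ²/σ²` is only half of the entropy guaranteed
at `ε`. Its separation is `ε/(2c)`, and `(ε/(2c))²/32` gives the constant `128`. -/
theorem le_minimaxRisk_of_le_localEntropy {m : ℕ} (hσ : 0 < σ)
    {K₁ : Set (EuclideanSpace ℝ (Fin m))} (hK₁ : Convex ℝ K₁)
    {K : Set (EuclideanSpace ℝ (Fin n))}
    {f : EuclideanSpace ℝ (Fin m) → EuclideanSpace ℝ (Fin n)} (hf : Isometry f)
    (hfK : Set.MapsTo f K₁ K) (c : ℝ≥0) {ε : ℝ≥0}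
    (h : (((ε : ℝ) ^ 2 / σ ^ 2 : ℝ) : EReal) ≤ localEntropy c K₁ ε) :
    ENNReal.ofReal (((ε : ℝ) / c) ^ 2 / 128) ≤ minimaxRisk σ K := by
  rcases eq_or_ne ε 0 with rfl | hε
  · simp
  have hε' : 0 < ε := pos_iff_ne_zero.2 hε
  have hεr : (0 : ℝ) < ε := by exact_mod_cast hε'
  set x : ℝ := (ε : ℝ) ^ 2 / σ ^ 2
  have hx : 0 < x := by positivity
  have h1 : ENNReal.ofReal (Real.exp x) ≤ (localPackingNumber c K₁ ε : ℝ≥0∞) := by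
    have := EReal.exp_monotone h
    rwa [localEntropy, ENNReal.exp_log, EReal.exp_coe] at this
  have h2 : ENNReal.ofReal (Real.exp (x / 2)) < (localPackingNumber c K₁ (ε / 2) : ℝ≥0∞) := by
    calc _ < ENNReal.ofReal (Real.exp x) := by
          rw [ENNReal.ofReal_lt_ofReal_iff (Real.exp_pos _), Real.exp_lt_exp]; linarith
      _ ≤ _ := h1
      _ ≤ _ := by
          exact_mod_cast localPackingNumber_antitone hK₁ c (by positivity)
            (div_le_self (zero_le) (by norm_num))
  -- Being strictly below the supremum, `j` is exceeded by the size of an actual packing, whether or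
  -- not the supremum is attained. The resulting `j + 1` points number at least `2` and at least
  -- `exp (x/2)`.
  set j : ℕ := ⌊Real.exp (x / 2)⌋₊
  have hj1 : 1 ≤ j := Nat.le_floor (by simpa using (half_pos hx).le)
  have hj2 : Real.exp (x / 2) ≤ (j + 1 : ℕ) := by
    exact_mod_cast (Nat.lt_floor_add_one (Real.exp (x / 2))).le
  have h3 : (j : ℕ∞) < localPackingNumber c K₁ (ε / 2) := by
    have h4 : ((j : ℕ∞) : ℝ≥0∞) < (localPackingNumber c K₁ (ε / 2) : ℝ≥0∞) := by
      refine lt_of_le_of_lt ?_ h2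
      rw [ENat.toENNReal_coe, ← ENNReal.ofReal_natCast]
      exact ENNReal.ofReal_le_ofReal (Nat.floor_le (Real.exp_pos _).le)
    exact_mod_cast h4
  simp only [localPackingNumber, Metric.packingNumber, lt_iSup_iff] at h3
  obtain ⟨θ, hθ, C, hC, hsep, hCj⟩ := h3
  obtain ⟨D, hDC, hD⟩ := Set.exists_subset_encard_eq (Order.add_one_le_of_lt hCj)
  have hDfin : D.Finite := Set.finite_of_encard_eq_coe (k := j + 1) (by exact_mod_cast hD)
  lift D to Finset (EuclideanSpace ℝ (Fin m)) using hDfin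
  rw [Set.encard_coe_eq_coe_finsetCard] at hD
  have hDcard : D.card = j + 1 := by exact_mod_cast hD
  have hcard : (D.map ⟨f, hf.injective⟩).card = j + 1 := by rw [Finset.card_map, hDcard]
  have key := le_minimaxRisk_of_separated (K := K) (T := D.map ⟨f, hf.injective⟩)
    (δ := ε / 2 / c) (ρ := ε / 2) (θ := f θ) hσ ?_ (by positivity) ?_ ?_ (by omega) ?_
  · refine le_trans (ENNReal.ofReal_le_ofReal (le_of_eq ?_)) key
    ring
  · intro s hs
    obtain ⟨u, hu, rfl⟩ := Finset.mem_map.1 hs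
    exact hfK (hC (hDC hu)).2
  · intro s hs s' hs' hne
    obtain ⟨u, hu, rfl⟩ := Finset.mem_map.1 hs
    obtain ⟨u', hu', rfl⟩ := Finset.mem_map.1 hs'
    have h5 : (↑(ε / 2 / c) : ℝ≥0∞) < edist u u' :=
      hsep (hDC hu) (hDC hu') (fun h => hne (by rw [h]))
    rw [edist_nndist, ENNReal.coe_lt_coe, ← NNReal.coe_lt_coe, coe_nndist] at h5
    simpa [hf.dist_eq] using h5
  · intro s hs
    obtain ⟨u, hu, rfl⟩ := Finset.mem_map.1 hs
    have h5 : dist u θ ≤ (ε / 2 : ℝ≥0) := (hC (hDC hu)).1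
    simpa [hf.dist_eq] using h5
  · rw [hcard, ← Real.exp_nat_mul]
    refine le_trans (Real.exp_le_exp.2 (le_of_eq ?_)) hj2
    simp only [x]
    push_cast
    ring

/-! ### Upper bound: nearest point of a maximal packing -/

/-- A maximal `c^j δ`-separated subset of the ball of radius `c^(j+1) δ` has at most `M` points by
monotonicity, and it covers. Each covering ball holds at most `M^(j+1)` points by induction, so
enlarging the radius by `c` costs one factor `M`. -/
theorem packingNumber_closedBall_pow_le {K : Set (EuclideanSpace ℝ (Fin n))}
    (hK : Convex ℝ K) {c δ : ℝ≥0} (hc : 1 ≤ c) (hδ : 0 < δ) {M : ℕ}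
    (hM : localPackingNumber c K (c * δ) ≤ M) (j : ℕ) :
    ∀ θ ∈ K, Metric.packingNumber δ (Metric.closedBall θ ((c ^ j * δ : ℝ≥0) : ℝ) ∩ K) ≤
      (M ^ (j + 1) : ℕ) := by
  have hc0 : 0 < c := one_pos.trans_le hc
  have hdiv : ∀ x : ℝ≥0, c * x / c = x := fun x => mul_div_cancel_left₀ x hc0.ne'
  induction j with
  | zero =>
    intro θ hθ
    have h1 : Metric.packingNumber (c * δ / c) (Metric.closedBall θ ((c * δ : ℝ≥0) : ℝ) ∩ K) ≤
        localPackingNumber c K (c * δ) := le_iSup₂_of_le θ hθ le_rfl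
    rw [hdiv] at h1
    rw [zero_add, pow_one]
    refine le_trans (iSup_le fun C => iSup_le fun hC => iSup_le fun hsep => ?_) (h1.trans hM)
    refine Metric.IsSeparated.encard_le_packingNumber (hC.trans ?_) hsep
    refine Set.inter_subset_inter_left _ (Metric.closedBall_subset_closedBall ?_)
    rw [pow_zero]
    exact_mod_cast mul_le_mul_left hc δ
  | succ j ih =>
    intro θ hθ
    set A := Metric.closedBall θ ((c ^ (j + 1) * δ : ℝ≥0) : ℝ) ∩ K
    have hpow : c ^ (j + 1) * δ = c * (c ^ j * δ) := by ring
    have h1 : Metric.packingNumber (c ^ j * δ) A ≤ M := by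
      have h2 : Metric.packingNumber (c ^ (j + 1) * δ / c) A ≤
          localPackingNumber c K (c ^ (j + 1) * δ) :=
        le_iSup₂_of_le (f := fun θ (_ : θ ∈ K) => Metric.packingNumber (c ^ (j + 1) * δ / c)
          (Metric.closedBall θ ((c ^ (j + 1) * δ : ℝ≥0) : ℝ) ∩ K)) θ hθ le_rfl
      rw [hpow, hdiv, ← hpow] at h2
      refine h2.trans ((localPackingNumber_antitone hK c (by positivity) ?_).trans hM)
      rw [hpow]
      gcongr
      exact le_mul_of_one_le_left' (one_le_pow₀ hc)
    have htop : Metric.packingNumber (c ^ j * δ) A ≠ ⊤ := ne_top_of_le_ne_top (by simp) h1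
    have hcov := Metric.isCover_maximalSeparatedSet htop
    have hNA := Metric.maximalSeparatedSet_subset (ε := c ^ j * δ) (A := A)
    rw [← Metric.encard_maximalSeparatedSet htop] at h1
    generalize Metric.maximalSeparatedSet (c ^ j * δ) A = N at hcov hNA h1
    have hfin : N.Finite := Set.encard_ne_top_iff.1 (ne_top_of_le_ne_top (by simp) h1)
    lift N to Finset (EuclideanSpace ℝ (Fin n)) using hfin
    rw [Set.encard_coe_eq_coe_finsetCard] at h1
    have hcard : N.card ≤ M := by exact_mod_cast h1
    refine iSup_le fun C => iSup_le fun hC => iSup_le fun hsep => ?_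
    let B : EuclideanSpace ℝ (Fin n) → Set (EuclideanSpace ℝ (Fin n)) :=
      fun z => C ∩ Metric.closedBall z ((c ^ j * δ : ℝ≥0) : ℝ)
    have hCB : C ⊆ ⋃ z ∈ N, B z := by
      intro x hx
      obtain ⟨z, hz, hxz⟩ := hcov (hC hx)
      refine Set.mem_iUnion₂.2 ⟨z, hz, hx, ?_⟩
      have h3 : edist x z ≤ (c ^ j * δ : ℝ≥0) := hxz
      rwa [edist_nndist, ENNReal.coe_le_coe, ← NNReal.coe_le_coe, coe_nndist] at h3
    calc C.encard ≤ (⋃ z ∈ N, B z).encard := Set.encard_le_encard hCB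
      _ ≤ ∑ z ∈ N, (B z).encard := N.set_encard_biUnion_le B
      _ ≤ ∑ z ∈ N, ((M ^ (j + 1) : ℕ) : ℕ∞) := by
          refine Finset.sum_le_sum fun z hz => ?_
          refine le_trans (Metric.IsSeparated.encard_le_packingNumber ?_
            (hsep.subset Set.inter_subset_left)) (ih z (hNA hz).2)
          exact fun x hx => ⟨hx.2, (hC hx.1).2⟩
      _ = ((N.card * M ^ (j + 1) : ℕ) : ℕ∞) := by
          rw [Finset.sum_const, nsmul_eq_mul, Nat.cast_mul]
      _ ≤ ((M ^ (j + 1 + 1) : ℕ) : ℕ∞) := by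
          rw [pow_succ' M (j + 1)]
          exact_mod_cast Nat.mul_le_mul_right _ hcard

theorem exists_measurable_nearest {E : Type*} [MetricSpace E] [MeasurableSpace E]
    [OpensMeasurableSpace E] {S : Finset E} (hS : S.Nonempty) :
    ∃ ν : E → E, Measurable ν ∧ ∀ y, ν y ∈ S ∧ ∀ s ∈ S, dist (ν y) y ≤ dist s y := by
  have hpos : 0 < S.card := hS.card_pos
  -- Clamping the index extends the enumeration of `S` to all of `ℕ` without leaving `S`.
  let e : ℕ → E := fun i => S.equivFin.symm ⟨min i (S.card - 1), by omega⟩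
  refine ⟨SimpleFunc.nearestPt e S.card, SimpleFunc.measurable _, fun y => ⟨?_, fun s hs => ?_⟩⟩
  · exact Subtype.coe_prop _
  · have h1 := SimpleFunc.edist_nearestPt_le e y (S.equivFin ⟨s, hs⟩).2.le
    have h2 : e (S.equivFin ⟨s, hs⟩) = s := by
      have h3 : min (S.equivFin ⟨s, hs⟩ : ℕ) (S.card - 1) = S.equivFin ⟨s, hs⟩ :=
        min_eq_left (by have := (S.equivFin ⟨s, hs⟩).2; omega)
      simp only [e, h3, Fin.eta, Equiv.symm_apply_apply]
    rw [h2] at h1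
    rw [edist_dist, edist_dist] at h1
    exact (ENNReal.ofReal_le_ofReal_iff dist_nonneg).1 h1

/-- The probability that an observation of `μ` is at least as close to `s` as to a point `s₀`
near `μ`. -/
theorem observationLaw_dist_le (hσ : 0 < σ) {μ s s₀ : EuclideanSpace ℝ (Fin n)} {δ : ℝ}
    (hμ : dist μ s₀ ≤ δ) (hs : 4 * δ ≤ dist s s₀) :
    observationLaw σ μ {y | dist s y ≤ dist s₀ y} ≤
      ENNReal.ofReal (Real.exp (-(dist s s₀ ^ 2 / (32 * σ ^ 2)))) := by
  -- Write `D = dist s s₀`. Preferring `s` forces an inner product of at least `D²/2` with `s - s₀`,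
  -- of which the offset of `μ` from `s₀` explains at most `D²/4`. Scaling by `1/4` optimises the
  -- Chernoff exponent: `D²/16 - D²/32`.
  have h1 := observationLaw_le_inner hσ μ ((4⁻¹ : ℝ) • (s - s₀)) (dist s s₀ ^ 2 / 16)
  have h2 : -((dist s s₀ ^ 2 / 16 - ‖(4⁻¹ : ℝ) • (s - s₀)‖ ^ 2 / 2) / σ ^ 2) =
      -(dist s s₀ ^ 2 / (32 * σ ^ 2)) := by
    rw [norm_smul, dist_eq_norm, Real.norm_of_nonneg (by norm_num)]
    field_simp
    ring
  rw [h2] at h1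
  refine (measure_mono fun y hy => ?_).trans h1
  have hy' : dist s y ≤ dist s₀ y := hy
  have h3 : dist s y ^ 2 ≤ dist s₀ y ^ 2 := by gcongr
  have h4 : dist s y ^ 2 = dist s₀ y ^ 2 + dist s s₀ ^ 2 - 2 * inner ℝ (y - s₀) (s - s₀) := by
    rw [dist_comm s y, dist_comm s₀ y, dist_eq_norm, dist_eq_norm, dist_eq_norm]
    have : y - s = (y - s₀) - (s - s₀) := by abel
    rw [this, norm_sub_sq_real]
    ring
  have h5 : inner ℝ (y - s₀) (s - s₀) = inner ℝ (y - μ) (s - s₀) + inner ℝ (μ - s₀) (s - s₀) := by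
    rw [← inner_add_left, sub_add_sub_cancel]
  have h6 : inner ℝ (μ - s₀) (s - s₀) ≤ δ * dist s s₀ := by
    refine (real_inner_le_norm _ _).trans ?_
    rw [← dist_eq_norm, ← dist_eq_norm]
    gcongr
  have h7 : δ * dist s s₀ ≤ dist s s₀ / 4 * dist s s₀ := by
    gcongr
    linarith
  change dist s s₀ ^ 2 / 16 ≤ inner ℝ (y - μ) ((4⁻¹ : ℝ) • (s - s₀))
  rw [inner_smul_right]
  nlinarith

/-- Landing on a point `s` means that `s` is at least as close to `y` as `s₀` is. Beyond radius `R`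
the loss is therefore bounded by a sum over `s` of such pairwise events. -/
theorem lintegral_nearest_le (hσ : 0 < σ) {S : Finset (EuclideanSpace ℝ (Fin n))}
    {ν : EuclideanSpace ℝ (Fin n) → EuclideanSpace ℝ (Fin n)}
    (hν : ∀ y, ν y ∈ S ∧ ∀ s ∈ S, dist (ν y) y ≤ dist s y)
    {μ s₀ : EuclideanSpace ℝ (Fin n)} {δ R : ℝ} (hs₀ : s₀ ∈ S) (hμ : dist μ s₀ ≤ δ)
    (hR : 4 * δ ≤ R) :
    ∫⁻ y, ‖ν y - s₀‖ₑ ^ 2 ∂(observationLaw σ μ) ≤ ENNReal.ofReal (R ^ 2 +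
      ∑ s ∈ S with R ≤ dist s s₀, dist s s₀ ^ 2 * Real.exp (-(dist s s₀ ^ 2 / (32 * σ ^ 2)))) := by
  have hδ : 0 ≤ δ := dist_nonneg.trans hμ
  set S' := S.filter fun s => R ≤ dist s s₀
  let A : EuclideanSpace ℝ (Fin n) → Set (EuclideanSpace ℝ (Fin n)) :=
    fun s => {y | dist s y ≤ dist s₀ y}
  have hA : ∀ s, MeasurableSet (A s) := fun s => measurableSet_le (by fun_prop) (by fun_prop)
  have hpt : ∀ y, ‖ν y - s₀‖ₑ ^ 2 ≤ ENNReal.ofReal (R ^ 2) +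
      ∑ s ∈ S', (A s).indicator (fun _ => ENNReal.ofReal (dist s s₀ ^ 2)) y := by
    intro y
    have h1 : ‖ν y - s₀‖ₑ ^ 2 = ENNReal.ofReal (dist (ν y) s₀ ^ 2) := by
      rw [dist_eq_norm, ENNReal.ofReal_pow (norm_nonneg _), ofReal_norm]
    rw [h1]
    by_cases h : R ≤ dist (ν y) s₀
    · refine le_add_left ?_
      have hmem : ν y ∈ S' := Finset.mem_filter.2 ⟨(hν y).1, h⟩
      refine le_trans (le_of_eq ?_) (Finset.single_le_sum
        (f := fun s => (A s).indicator (fun _ => ENNReal.ofReal (dist s s₀ ^ 2)) y)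
        (fun _ _ => zero_le) hmem)
      have : y ∈ A (ν y) := (hν y).2 s₀ hs₀
      simp only [Set.indicator_of_mem this]
    · refine le_add_right (ENNReal.ofReal_le_ofReal ?_)
      have := not_le.1 h
      gcongr
  calc ∫⁻ y, ‖ν y - s₀‖ₑ ^ 2 ∂(observationLaw σ μ)
      ≤ ∫⁻ y, (ENNReal.ofReal (R ^ 2) + ∑ s ∈ S',
          (A s).indicator (fun _ => ENNReal.ofReal (dist s s₀ ^ 2)) y) ∂(observationLaw σ μ) :=
        lintegral_mono hpt
    _ = ENNReal.ofReal (R ^ 2) +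
          ∑ s ∈ S', ENNReal.ofReal (dist s s₀ ^ 2) * observationLaw σ μ (A s) := by
        rw [lintegral_add_left measurable_const, lintegral_const, measure_univ, mul_one,
          lintegral_finsetSum _ fun s _ => measurable_const.indicator (hA s)]
        congr 1
        exact Finset.sum_congr rfl fun s _ => lintegral_indicator_const (hA s) _
    _ ≤ ENNReal.ofReal (R ^ 2) + ∑ s ∈ S', ENNReal.ofReal (dist s s₀ ^ 2) *
          ENNReal.ofReal (Real.exp (-(dist s s₀ ^ 2 / (32 * σ ^ 2)))) := by
        gcongr with s hs
        exact observationLaw_dist_le hσ hμ (hR.trans (Finset.mem_filter.1 hs).2)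
    _ = _ := by
        rw [ENNReal.ofReal_add (by positivity) (Finset.sum_nonneg fun s _ => by positivity),
          ENNReal.ofReal_sum_of_nonneg fun s _ => by positivity]
        simp_rw [ENNReal.ofReal_mul (sq_nonneg _)]

/-- The bound for shell `i` in the peeling. With `u = c^(2(i+1)) x / 64`, half of the Gaussian
exponent `2u` absorbs the count `(i + 4) x`. The remaining `exp (-u) ≤ 2/u²` beats the squared
distance and leaves `c^(-2i) ≤ 2^(-i)`. -/
theorem pow_mul_exp_le {c x ε : ℝ} (hc : 16 ≤ c) (hx : 1 ≤ x) (i : ℕ) :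
    Real.exp ((i + 4) * x) * (c ^ (2 * (i + 2)) * ε ^ 2 *
      Real.exp (-(c ^ (2 * (i + 1)) * x / 32))) ≤ 8192 * ε ^ 2 * (1 / 2) ^ i := by
  have hc0 : 0 < c := by linarith
  set p := c ^ (2 * i)
  have hp1 : (256 : ℝ) ^ i ≤ p := by
    simp only [p]
    rw [pow_mul]
    gcongr
    nlinarith
  have hp2 : (1 : ℝ) + i * 255 ≤ 256 ^ i := by
    have := one_add_mul_le_pow (by norm_num : (-2 : ℝ) ≤ 255) i
    norm_num at this ⊢
    exact this
  have hp3 : (2 : ℝ) ^ i ≤ p := le_trans (by gcongr; norm_num) hp1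
  have hp0 : 0 < p := by positivity
  have hi : (0 : ℝ) ≤ i := by positivity
  have hq : c ^ (2 * (i + 1)) = c ^ 2 * p := by simp only [p]; ring
  have hr : c ^ (2 * (i + 2)) = c ^ 4 * p := by simp only [p]; ring
  have hc2 : 256 ≤ c ^ 2 := by nlinarith
  have hcp : 64 * ((i : ℝ) + 4) ≤ c ^ 2 * p := by nlinarith
  set u := c ^ 2 * p * x / 64
  have hu : c ^ 2 * p / 64 ≤ u := by
    have : c ^ 2 * p ≤ c ^ 2 * p * x := le_mul_of_one_le_right (by positivity) hx
    simp only [u]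
    gcongr
  have hu0 : 0 < u := lt_of_lt_of_le (by positivity) hu
  have h1 : (i + 4) * x - c ^ 2 * p * x / 32 ≤ -u := by
    simp only [u]
    nlinarith
  have h2 : u ^ 2 / 2 ≤ Real.exp u := by
    have := Real.quadratic_le_exp_of_nonneg hu0.le
    linarith
  have h3 : Real.exp (-u) ≤ 2 / (c ^ 2 * p / 64) ^ 2 := by
    rw [Real.exp_neg, inv_le_comm₀ (Real.exp_pos _) (by positivity)]
    refine le_trans ?_ h2
    rw [inv_div]
    gcongr
  calc _ = c ^ 4 * p * ε ^ 2 * Real.exp ((i + 4) * x - c ^ 2 * p * x / 32) := by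
        rw [hq, hr, sub_eq_add_neg, Real.exp_add]; ring
    _ ≤ c ^ 4 * p * ε ^ 2 * (2 / (c ^ 2 * p / 64) ^ 2) := by
        gcongr
        exact (Real.exp_le_exp.2 h1).trans h3
    _ = 8192 * ε ^ 2 * (1 / p) := by field_simp; ring
    _ ≤ _ := by
        rw [one_div_pow]
        gcongr

/-- Peeling over the shells `c ^ j * δ ≤ dist s s₀ < c ^ (j + 1) * δ`. -/
theorem sum_sq_mul_exp_le {E : Type*} [MetricSpace E] {S : Finset E} {s₀ : E} {c δ : ℝ}
    (hσ : 0 < σ) (hc : 16 ≤ c) (hδ : 0 < δ) (hx : 1 ≤ (c * δ) ^ 2 / σ ^ 2)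
    (hcount : ∀ j : ℕ, ((S.filter fun s => dist s s₀ ≤ c ^ j * δ).card : ℝ) ≤
      Real.exp ((j + 1) * ((c * δ) ^ 2 / σ ^ 2))) :
    ∑ s ∈ S with c ^ 2 * δ ≤ dist s s₀,
      dist s s₀ ^ 2 * Real.exp (-(dist s s₀ ^ 2 / (32 * σ ^ 2))) ≤ 16384 * (c * δ) ^ 2 := by
  have hc0 : 0 < c := by linarith
  set x := (c * δ) ^ 2 / σ ^ 2
  set S' := S.filter fun s => c ^ 2 * δ ≤ dist s s₀
  have hshell : ∀ s ∈ S', ∃ i : ℕ, c ^ (i + 2) * δ ≤ dist s s₀ ∧ dist s s₀ ≤ c ^ (i + 3) * δ := by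
    intro s hs
    have h1 := (Finset.mem_filter.1 hs).2
    have h2 : 1 ≤ dist s s₀ / (c ^ 2 * δ) := (one_le_div (by positivity)).2 h1
    obtain ⟨i, hi1, hi2⟩ := exists_nat_pow_near h2 (by linarith : 1 < c)
    rw [le_div_iff₀ (by positivity)] at hi1
    rw [div_lt_iff₀ (by positivity)] at hi2
    refine ⟨i, le_trans (le_of_eq (by ring)) hi1, hi2.le.trans (le_of_eq (by ring))⟩
  choose! J hJ using hshell
  have hfib : ∀ i, ∑ s ∈ S' with J s = i,
      dist s s₀ ^ 2 * Real.exp (-(dist s s₀ ^ 2 / (32 * σ ^ 2))) ≤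
        8192 * (c * δ) ^ 2 * (1 / 2) ^ i := by
    intro i
    refine le_trans ?_ (pow_mul_exp_le hc hx i)
    have hterm : ∀ s ∈ S'.filter (J · = i),
        dist s s₀ ^ 2 * Real.exp (-(dist s s₀ ^ 2 / (32 * σ ^ 2))) ≤
          c ^ (2 * (i + 2)) * (c * δ) ^ 2 * Real.exp (-(c ^ (2 * (i + 1)) * x / 32)) := by
      intro s hs
      obtain ⟨hs', rfl⟩ := Finset.mem_filter.1 hs
      obtain ⟨h1, h2⟩ := hJ s hs'
      refine mul_le_mul ?_ (Real.exp_le_exp.2 (neg_le_neg ?_)) (Real.exp_pos _).le (by positivity)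
      · calc dist s s₀ ^ 2 ≤ (c ^ (J s + 3) * δ) ^ 2 := by gcongr
          _ = _ := by ring
      · calc c ^ (2 * (J s + 1)) * x / 32 = (c ^ (J s + 2) * δ) ^ 2 / (32 * σ ^ 2) := by
              simp only [x]; field_simp; ring
          _ ≤ _ := by gcongr
    refine (Finset.sum_le_card_nsmul _ _ _ hterm).trans ?_
    rw [nsmul_eq_mul]
    gcongr
    -- Shell `i` lies in the ball of radius `c^(i+3) δ`, hence the exponent `i + 4`.
    refine le_trans ?_ ((hcount (i + 3)).trans (le_of_eq ?_))
    · gcongr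
      intro s hs
      obtain ⟨hs', rfl⟩ := Finset.mem_filter.1 hs
      exact Finset.mem_filter.2 ⟨(Finset.mem_filter.1 hs').1, (hJ s hs').2⟩
    · push_cast
      ring_nf
  rw [← Finset.sum_fiberwise_of_maps_to (t := S'.image J) fun s hs => Finset.mem_image_of_mem J hs]
  calc _ ≤ ∑ i ∈ S'.image J, 8192 * (c * δ) ^ 2 * (1 / 2 : ℝ) ^ i :=
        Finset.sum_le_sum fun i _ => hfib i
    _ = 8192 * (c * δ) ^ 2 * ∑ i ∈ S'.image J, (1 / 2 : ℝ) ^ i := by rw [Finset.mul_sum]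
    _ ≤ 8192 * (c * δ) ^ 2 * 2 := by
        gcongr
        exact (summable_geometric_two.sum_le_tsum _ fun i _ => by positivity).trans_eq
          tsum_geometric_two
    _ = _ := by ring

theorem exists_estimator_of_localEntropy_lt (hσ : 0 < σ) {K : Set (EuclideanSpace ℝ (Fin n))}
    (hne : K.Nonempty) (hb : Bornology.IsBounded K) (hK : Convex ℝ K) {c ε : ℝ≥0} (hc : 16 ≤ c)
    (hε : σ ≤ ε) (h : localEntropy c K ε < (((ε : ℝ) ^ 2 / σ ^ 2 : ℝ) : EReal)) :
    ∃ ν : EuclideanSpace ℝ (Fin n) → EuclideanSpace ℝ (Fin n), Measurable ν ∧ ∀ μ ∈ K,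
      ∫⁻ y, ‖ν y - μ‖ₑ ^ 2 ∂(observationLaw σ μ) ≤
        ENNReal.ofReal ((2 * (c : ℝ) ^ 2 + 32770) * (ε : ℝ) ^ 2) := by
  have hcr : (16 : ℝ) ≤ c := by exact_mod_cast hc
  have hc0 : 0 < c := lt_of_lt_of_le (by norm_num) hc
  have hc1 : 1 ≤ c := le_trans (by norm_num) hc
  have hεr : (0 : ℝ) < ε := hσ.trans_le hε
  have hε0 : 0 < ε := by exact_mod_cast hεr
  obtain ⟨δ, rfl⟩ : ∃ δ : ℝ≥0, ε = c * δ := ⟨ε / c, (mul_div_cancel₀ ε hc0.ne').symm⟩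
  have hδ : 0 < δ := pos_of_mul_pos_right hε0 zero_le
  have hδr : (0 : ℝ) < δ := by exact_mod_cast hδ
  set x : ℝ := ((c * δ : ℝ≥0) : ℝ) ^ 2 / σ ^ 2
  have hx : 1 ≤ x := by
    rw [one_le_div (by positivity)]
    gcongr
  obtain ⟨M, hM, hMx⟩ : ∃ M : ℕ, localPackingNumber c K (c * δ) ≤ M ∧ (M : ℝ) ≤ Real.exp x := by
    have h1 := EReal.exp_strictMono h
    rw [localEntropy, ENNReal.exp_log, EReal.exp_coe] at h1
    have h2 : localPackingNumber c K (c * δ) ≠ ⊤ := by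
      rintro h2
      rw [h2] at h1
      simp at h1
    obtain ⟨M, hM⟩ := ENat.ne_top_iff_exists.1 h2
    refine ⟨M, hM.ge, ?_⟩
    rw [← hM, ENat.toENNReal_coe, ← ENNReal.ofReal_natCast] at h1
    exact (ENNReal.ofReal_le_ofReal_iff (Real.exp_pos _).le).1 h1.le
  have hpack := packingNumber_closedBall_pow_le hK hc1 hδ hM
  obtain ⟨θ, hθ⟩ := hne
  -- A bounded set lies in some ball of radius `c^j δ`, where the packing bound is finite.
  have hKtop : Metric.packingNumber δ K ≠ ⊤ := by
    obtain ⟨r, hr⟩ := hb.subset_closedBall θ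
    obtain ⟨j, hj⟩ := pow_unbounded_of_one_lt (r / δ) (by linarith : (1 : ℝ) < c)
    rw [div_lt_iff₀ hδr] at hj
    have h1 := hpack j θ hθ
    rw [Set.inter_eq_right.2 (hr.trans (Metric.closedBall_subset_closedBall
      (by push_cast; exact hj.le)))] at h1
    exact ne_top_of_le_ne_top (by simp) h1
  have hcov := Metric.isCover_maximalSeparatedSet hKtop
  have hSK := Metric.maximalSeparatedSet_subset (ε := δ) (A := K)
  have hsep := Metric.isSeparated_maximalSeparatedSet (ε := δ) (A := K)
  have hfin : (Metric.maximalSeparatedSet δ K).Finite := by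
    rw [← Set.encard_ne_top_iff, Metric.encard_maximalSeparatedSet hKtop]
    exact hKtop
  generalize Metric.maximalSeparatedSet δ K = S at hcov hSK hsep hfin
  lift S to Finset (EuclideanSpace ℝ (Fin n)) using hfin
  have hSne : S.Nonempty := by
    obtain ⟨s, hs, -⟩ := hcov hθ
    exact ⟨s, hs⟩
  obtain ⟨ν, hν, hν'⟩ := exists_measurable_nearest hSne
  refine ⟨ν, hν, fun μ hμ => ?_⟩
  obtain ⟨s₀, hs₀, hμs⟩ := hcov hμ
  have hμs' : dist μ s₀ ≤ δ := by
    have h3 : edist μ s₀ ≤ δ := hμs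
    rwa [edist_nndist, ENNReal.coe_le_coe, ← NNReal.coe_le_coe, coe_nndist] at h3
  have hcount : ∀ j : ℕ, ((S.filter fun s => dist s s₀ ≤ (c : ℝ) ^ j * δ).card : ℝ) ≤
      Real.exp ((j + 1) * x) := by
    intro j
    have h1 : (((S.filter fun s => dist s s₀ ≤ (c : ℝ) ^ j * δ) : Finset _) :
        Set (EuclideanSpace ℝ (Fin n))).encard ≤ (M ^ (j + 1) : ℕ) := by
      refine le_trans (Metric.IsSeparated.encard_le_packingNumber ?_ (hsep.subset ?_))
        (hpack j s₀ (hSK hs₀))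
      · intro s hs
        obtain ⟨hs1, hs2⟩ := Finset.mem_filter.1 hs
        exact ⟨by simpa using hs2, hSK hs1⟩
      · exact_mod_cast Finset.filter_subset _ _
    rw [Set.encard_coe_eq_coe_finsetCard] at h1
    have h2 : (S.filter fun s => dist s s₀ ≤ (c : ℝ) ^ j * δ).card ≤ M ^ (j + 1) := by
      exact_mod_cast h1
    calc ((S.filter fun s => dist s s₀ ≤ (c : ℝ) ^ j * δ).card : ℝ) ≤ (M : ℝ) ^ (j + 1) := by
          exact_mod_cast h2
      _ ≤ Real.exp x ^ (j + 1) := by gcongr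
      _ = _ := by rw [← Real.exp_nat_mul]; push_cast; rfl
  have hxe : x = ((c : ℝ) * δ) ^ 2 / σ ^ 2 := by simp only [x]; push_cast; rfl
  rw [hxe] at hx hcount
  have hsum := sum_sq_mul_exp_le hσ hcr hδr hx hcount
  have hR : 4 * (δ : ℝ) ≤ (c : ℝ) ^ 2 * δ := by
    gcongr
    nlinarith
  have hnear : ∫⁻ y, ‖ν y - s₀‖ₑ ^ 2 ∂(observationLaw σ μ) ≤
      ENNReal.ofReal (((c : ℝ) ^ 2 + 16384) * ((c : ℝ) * δ) ^ 2) := by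
    refine (lintegral_nearest_le hσ hν' hs₀ hμs' hR).trans (ENNReal.ofReal_le_ofReal ?_)
    nlinarith
  have hpt : ∀ y, ‖ν y - μ‖ₑ ^ 2 ≤ ENNReal.ofReal 2 * ‖ν y - s₀‖ₑ ^ 2 + ENNReal.ofReal (2 * (δ : ℝ) ^ 2) := by
    intro y
    rw [← ofReal_norm, ← ofReal_norm, ← ENNReal.ofReal_pow (norm_nonneg _),
      ← ENNReal.ofReal_pow (norm_nonneg _),
      ← ENNReal.ofReal_mul (by norm_num), ← ENNReal.ofReal_add (by positivity) (by positivity)]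
    apply ENNReal.ofReal_le_ofReal
    have h1 : ‖ν y - μ‖ ≤ ‖ν y - s₀‖ + δ := by
      have := dist_triangle_right (ν y) μ s₀
      rw [← dist_eq_norm, ← dist_eq_norm]
      linarith
    have h2 : ‖ν y - μ‖ ^ 2 ≤ (‖ν y - s₀‖ + δ) ^ 2 := by gcongr
    nlinarith [sq_nonneg (‖ν y - s₀‖ - δ)]
  calc ∫⁻ y, ‖ν y - μ‖ₑ ^ 2 ∂(observationLaw σ μ)
      ≤ ∫⁻ y, (ENNReal.ofReal 2 * ‖ν y - s₀‖ₑ ^ 2 + ENNReal.ofReal (2 * (δ : ℝ) ^ 2))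
          ∂(observationLaw σ μ) := lintegral_mono hpt
    _ = ENNReal.ofReal 2 * ∫⁻ y, ‖ν y - s₀‖ₑ ^ 2 ∂(observationLaw σ μ) +
          ENNReal.ofReal (2 * (δ : ℝ) ^ 2) := by
        rw [lintegral_add_right _ measurable_const, lintegral_const, measure_univ, mul_one,
          lintegral_const_mul _ (by fun_prop)]
    _ ≤ ENNReal.ofReal 2 * ENNReal.ofReal (((c : ℝ) ^ 2 + 16384) * ((c : ℝ) * δ) ^ 2) +
          ENNReal.ofReal (2 * (δ : ℝ) ^ 2) := by gcongr
    _ ≤ _ := by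
        rw [← ENNReal.ofReal_mul (by norm_num),
          ← ENNReal.ofReal_add (by positivity) (by positivity)]
        apply ENNReal.ofReal_le_ofReal
        -- `32770 = 2 · 16384 + 2`; the final `2` pays for the distance from `μ` to the net, as `δ ≤
        -- cδ`.
        push_cast
        have : (δ : ℝ) ^ 2 ≤ ((c : ℝ) * δ) ^ 2 := by
          gcongr
          nlinarith
        linarith

/-! ### Risk at the critical radius -/

/-- Two points of a segment at distance exactly `ε` form an `ε/c`-packing since `c > 1`, and `log 2`
exceeds `1/4 ≥ ε²/σ²`. This bounds the critical radius below in terms of `σ`. -/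
theorem le_localEntropy_of_dist {K : Set (EuclideanSpace ℝ (Fin n))} (hK : Convex ℝ K)
    {c ε : ℝ≥0} (hc : 1 < c) (hσ : 0 < σ) (hε : 0 < ε) (hεσ : (ε : ℝ) ≤ σ / 2)
    {x y : EuclideanSpace ℝ (Fin n)} (hx : x ∈ K) (hy : y ∈ K) (hxy : ε ≤ dist x y) :
    (((ε : ℝ) ^ 2 / σ ^ 2 : ℝ) : EReal) ≤ localEntropy c K ε := by
  have hεr : (0 : ℝ) < ε := by exact_mod_cast hε
  have hd : 0 < dist x y := hεr.trans_le hxy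
  set z := AffineMap.lineMap x y ((ε : ℝ) / dist x y)
  have hz : z ∈ K := hK.lineMap_mem hx hy ⟨by positivity, (div_le_one hd).2 hxy⟩
  have hzx : dist x z = ε := by
    rw [dist_left_lineMap, Real.norm_of_nonneg (by positivity)]
    field_simp
  have hne : x ≠ z := by
    rw [← dist_pos, hzx]
    exact hεr
  have h2 : (2 : ℕ∞) ≤ localPackingNumber c K ε := by
    refine le_trans ?_ (le_iSup₂_of_le x hx le_rfl)
    rw [← Set.encard_pair hne]
    refine Metric.IsSeparated.encard_le_packingNumber ?_ ?_
    · rintro w (rfl | rfl)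
      · exact ⟨Metric.mem_closedBall_self hεr.le, hx⟩
      · exact ⟨by rw [Metric.mem_closedBall, dist_comm, hzx], hz⟩
    · have hlt : (↑(ε / c) : ℝ≥0∞) < edist x z := by
        rw [edist_nndist, ENNReal.coe_lt_coe, ← NNReal.coe_lt_coe, coe_nndist, hzx]
        exact_mod_cast div_lt_self hε hc
      rintro a (rfl | rfl) b (rfl | rfl) hab
      · exact absurd rfl hab
      · exact hlt
      · rwa [edist_comm]
      · exact absurd rfl hab
  rw [← EReal.exp_le_exp_iff, localEntropy, ENNReal.exp_log, EReal.exp_coe]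
  calc ENNReal.ofReal (Real.exp ((ε : ℝ) ^ 2 / σ ^ 2)) ≤ ENNReal.ofReal 2 := by
        apply ENNReal.ofReal_le_ofReal
        rw [← Real.le_log_iff_exp_le (by norm_num)]
        have h3 : (ε : ℝ) ^ 2 / σ ^ 2 ≤ (σ / 2) ^ 2 / σ ^ 2 := by gcongr
        have h4 : (σ / 2) ^ 2 / σ ^ 2 = 1 / 4 := by field_simp; norm_num
        have := Real.log_two_gt_d9
        linarith
    _ = ((2 : ℕ∞) : ℝ≥0∞) := by simp
    _ ≤ _ := by exact_mod_cast h2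

/-- If the diameter is at most `2ε*`, any constant in `K` works. Otherwise the entropy inequality
fails at `2ε*`, and the net estimator at that radius has risk of order `ε*²`, which is then the
minimum. -/
theorem exists_estimator_le_criticalRadius (hσ : 0 < σ) {K : Set (EuclideanSpace ℝ (Fin n))}
    (hne : K.Nonempty) (hb : Bornology.IsBounded K) (hK : Convex ℝ K) {c : ℝ≥0} (hc : 16 ≤ c) :
    ∃ ν : EuclideanSpace ℝ (Fin n) → EuclideanSpace ℝ (Fin n), Measurable ν ∧ ∀ μ ∈ K,
      ∫⁻ y, ‖ν y - μ‖ₑ ^ 2 ∂(observationLaw σ μ) ≤ ((4 * (2 * c ^ 2 + 32770) : ℝ≥0) : ℝ≥0∞) *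
        min (criticalRadius σ (localEntropy c K) ^ 2) (Metric.ediam K ^ 2) := by
  have hmem : ∀ ε : ℝ≥0, (((ε : ℝ) ^ 2 / σ ^ 2 : ℝ) : EReal) ≤ localEntropy c K ε →
      (ε : ℝ≥0∞) ≤ criticalRadius σ (localEntropy c K) := fun ε h => le_sSup ⟨ε, rfl, h⟩
  rcases le_or_gt (Metric.ediam K) (2 * criticalRadius σ (localEntropy c K)) with h | h
  · obtain ⟨θ, hθ⟩ := hne
    refine ⟨fun _ => θ, measurable_const, fun μ hμ => ?_⟩
    have h1 : ‖θ - μ‖ₑ ≤ Metric.ediam K := by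
      rw [← edist_eq_enorm_sub]
      exact Metric.edist_le_ediam_of_mem hθ hμ
    have h2 : Metric.ediam K ^ 2 ≤
        4 * min (criticalRadius σ (localEntropy c K) ^ 2) (Metric.ediam K ^ 2) := by
      rw [mul_min]
      refine le_min ?_ ?_
      · calc _ ≤ (2 * criticalRadius σ (localEntropy c K)) ^ 2 := by gcongr
          _ = _ := by ring
      · exact le_mul_of_one_le_left' (by norm_num)
    calc _ = ‖θ - μ‖ₑ ^ 2 := by rw [lintegral_const, measure_univ, mul_one]
      _ ≤ Metric.ediam K ^ 2 := by gcongr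
      _ ≤ 4 * min (criticalRadius σ (localEntropy c K) ^ 2) (Metric.ediam K ^ 2) := h2
      _ ≤ _ := by
          gcongr
          have : (4 : ℝ≥0) ≤ 4 * (2 * c ^ 2 + 32770) := by
            refine le_mul_of_one_le_right zero_le ?_
            refine le_add_left (by norm_num)
          exact_mod_cast this
  · have htop : criticalRadius σ (localEntropy c K) ≠ ⊤ := by
      rintro h1
      simp [h1] at h
    generalize criticalRadius σ (localEntropy c K) = ρ at hmem h htop
    lift ρ to ℝ≥0 using htop
    obtain ⟨x, hx, y, hy, hxy⟩ : ∃ x ∈ K, ∃ y ∈ K, 2 * (ρ : ℝ≥0∞) < edist x y := by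
      simpa only [Metric.ediam, lt_iSup_iff, exists_prop] using h
    have hxy' : 2 * ρ < nndist x y := by
      rw [edist_nndist] at hxy
      exact_mod_cast hxy
    -- Were `2ρ < σ`, the radius `min (dist x y) (σ/2)` would satisfy the entropy inequality and
    -- exceed the critical radius `ρ`.
    have hρσ : σ ≤ (2 * ρ : ℝ≥0) := by
      by_contra! hlt
      push_cast at hlt
      have hσ' : ((σ / 2).toNNReal : ℝ) = σ / 2 := Real.coe_toNNReal _ (by positivity)
      have h1 : ρ < min (nndist x y) (σ / 2).toNNReal := by
        refine lt_min (lt_of_le_of_lt ?_ hxy') ?_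
        · exact le_mul_of_one_le_left zero_le (by norm_num)
        · rw [← NNReal.coe_lt_coe, hσ']
          linarith
      have h2 := hmem _ (le_localEntropy_of_dist hK (lt_of_lt_of_le (by norm_num) hc) hσ
        (zero_le.trans_lt h1) ((NNReal.coe_le_coe.2 (min_le_right _ _)).trans_eq hσ') hx hy
        (by rw [← coe_nndist]; exact NNReal.coe_le_coe.2 (min_le_left _ _)))
      exact absurd (ENNReal.coe_le_coe.1 h2) (not_le.2 h1)
    have hρ : 0 < ρ := by
      have : (0 : ℝ) < (2 * ρ : ℝ≥0) := hσ.trans_le hρσ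
      push_cast at this
      exact_mod_cast (by linarith : (0 : ℝ) < ρ)
    have hlt : localEntropy c K (2 * ρ) < ((((2 * ρ : ℝ≥0) : ℝ) ^ 2 / σ ^ 2 : ℝ) : EReal) := by
      by_contra! hle
      have h1 := ENNReal.coe_le_coe.1 (hmem _ hle)
      exact absurd h1 (not_le.2 (lt_mul_of_one_lt_left hρ (by norm_num)))
    obtain ⟨ν, hν, hrisk⟩ := exists_estimator_of_localEntropy_lt hσ hne hb hK hc hρσ hlt
    refine ⟨ν, hν, fun μ hμ => (hrisk μ hμ).trans ?_⟩
    have h1 : (ρ : ℝ≥0∞) ≤ Metric.ediam K :=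
      le_trans (le_mul_of_one_le_left' (by norm_num)) h.le
    rw [min_eq_left (by gcongr)]
    refine le_of_eq ?_
    have h2 : (2 * (c : ℝ) ^ 2 + 32770) * ((2 * ρ : ℝ≥0) : ℝ) ^ 2 =
        ((4 * (2 * c ^ 2 + 32770) * ρ ^ 2 : ℝ≥0) : ℝ) := by push_cast; ring
    rw [h2, ENNReal.ofReal_coe_nnreal]
    push_cast
    rfl

/-! ### Cartesian products -/

variable {m : ℕ}

/-- Selecting distinct coordinates preserves independence and their marginals, so each block of `Y`
is again a Gaussian sequence observation. -/
theorem observationLaw_map_precomp {k : ℕ} (μ : EuclideanSpace ℝ (Fin k)) {e : Fin m → Fin k}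
    (he : Function.Injective e) :
    (observationLaw σ μ).map (fun x => WithLp.toLp 2 fun i => x (e i)) =
      observationLaw σ (WithLp.toLp 2 fun i => μ (e i)) := by
  have hind : iIndepFun (fun i (x : Fin k → ℝ) => x i)
      (Measure.pi fun i => gaussianReal (μ i) (σ ^ 2).toNNReal) :=
    iIndepFun_pi (X := fun _ x => x) fun i => aemeasurable_id
  have hmap := (iIndepFun_iff_map_fun_eq_pi_map
    (fun i => (measurable_pi_apply (e i)).aemeasurable)).1 (hind.precomp he)
  have heval : ∀ i, (Measure.pi fun i => gaussianReal (μ i) (σ ^ 2).toNNReal).map (fun x => x i) =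
      gaussianReal (μ i) (σ ^ 2).toNNReal := fun i => (measurePreserving_eval _ i).map_eq
  simp_rw [heval] at hmap
  have hT := WithLp.measurable_toLp 2 (Fin m → ℝ)
  have hT' := WithLp.measurable_toLp 2 (Fin k → ℝ)
  rw [observationLaw, observationLaw, Measure.map_map (by fun_prop) hT']
  simp only
  rw [← hmap, Measure.map_map hT (by fun_prop)]
  rfl

/-- The point of `ℝ^(m + n)` whose first coordinates form `u` and whose last ones form `v`. -/
noncomputable def append (u : EuclideanSpace ℝ (Fin m)) (v : EuclideanSpace ℝ (Fin n)) :
    EuclideanSpace ℝ (Fin (m + n)) :=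
  WithLp.toLp 2 (Fin.append u v)

theorem append_mem_cartesianProduct {K₁ : Set (EuclideanSpace ℝ (Fin m))}
    {K₂ : Set (EuclideanSpace ℝ (Fin n))} {u : EuclideanSpace ℝ (Fin m)}
    {v : EuclideanSpace ℝ (Fin n)} (hu : u ∈ K₁) (hv : v ∈ K₂) :
    append u v ∈ cartesianProduct K₁ K₂ := by
  simpa [cartesianProduct, append] using ⟨hu, hv⟩

theorem norm_append_sub_sq (u : EuclideanSpace ℝ (Fin m)) (v : EuclideanSpace ℝ (Fin n))
    (x : EuclideanSpace ℝ (Fin (m + n))) :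
    ‖append u v - x‖ ^ 2 = ‖u - WithLp.toLp 2 fun i : Fin m => x (Fin.castAdd n i)‖ ^ 2 +
      ‖v - WithLp.toLp 2 fun j : Fin n => x (Fin.natAdd m j)‖ ^ 2 := by
  simp [EuclideanSpace.real_norm_sq_eq, Fin.sum_univ_add, append]

theorem isometry_append_left (v : EuclideanSpace ℝ (Fin n)) :
    Isometry fun u : EuclideanSpace ℝ (Fin m) => append u v := by
  refine Isometry.of_dist_eq fun u u' => ?_
  rw [dist_eq_norm, dist_eq_norm, ← sq_eq_sq₀ (norm_nonneg _) (norm_nonneg _), norm_append_sub_sq]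
  simp [append]

theorem isometry_append_right (u : EuclideanSpace ℝ (Fin m)) :
    Isometry fun v : EuclideanSpace ℝ (Fin n) => append u v := by
  refine Isometry.of_dist_eq fun v v' => ?_
  rw [dist_eq_norm, dist_eq_norm, ← sq_eq_sq₀ (norm_nonneg _) (norm_nonneg _), norm_append_sub_sq]
  simp [append]

theorem ediam_le_of_isometry_mapsTo {E F : Type*} [PseudoEMetricSpace E] [PseudoEMetricSpace F]
    {f : E → F} (hf : Isometry f) {s : Set E} {t : Set F} (h : Set.MapsTo f s t) :
    Metric.ediam s ≤ Metric.ediam t := by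
  rw [← hf.ediam_image]
  exact Metric.ediam_mono h.image_subset

/-- By Pythagoras the loss splits over the two blocks, and each term depends on its own block of the
data only. -/
theorem minimaxRisk_cartesianProduct_le {K₁ : Set (EuclideanSpace ℝ (Fin m))}
    {K₂ : Set (EuclideanSpace ℝ (Fin n))}
    {ν₁ : EuclideanSpace ℝ (Fin m) → EuclideanSpace ℝ (Fin m)}
    {ν₂ : EuclideanSpace ℝ (Fin n) → EuclideanSpace ℝ (Fin n)}
    (hν₁ : Measurable ν₁) (hν₂ : Measurable ν₂) {R₁ R₂ : ℝ≥0∞}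
    (h₁ : ∀ μ ∈ K₁, ∫⁻ y, ‖ν₁ y - μ‖ₑ ^ 2 ∂(observationLaw σ μ) ≤ R₁)
    (h₂ : ∀ μ ∈ K₂, ∫⁻ y, ‖ν₂ y - μ‖ₑ ^ 2 ∂(observationLaw σ μ) ≤ R₂) :
    minimaxRisk σ (cartesianProduct K₁ K₂) ≤ R₁ + R₂ := by
  let p₁ : EuclideanSpace ℝ (Fin (m + n)) → EuclideanSpace ℝ (Fin m) :=
    fun x => WithLp.toLp 2 fun i => x (Fin.castAdd n i)
  let p₂ : EuclideanSpace ℝ (Fin (m + n)) → EuclideanSpace ℝ (Fin n) :=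
    fun x => WithLp.toLp 2 fun j => x (Fin.natAdd m j)
  have hp₁ : Measurable p₁ := by fun_prop
  have hp₂ : Measurable p₂ := by fun_prop
  have hν : Measurable fun y => append (ν₁ (p₁ y)) (ν₂ (p₂ y)) := by
    refine (WithLp.measurable_toLp 2 _).comp (measurable_pi_lambda _ fun i => ?_)
    refine Fin.addCases (fun i => ?_) (fun j => ?_) i
    · simp only [Fin.append_left]
      fun_prop
    · simp only [Fin.append_right]
      fun_prop
  refine iInf₂_le_of_le _ hν (iSup₂_le fun μ hμ => ?_)
  have hpt : ∀ y, ‖append (ν₁ (p₁ y)) (ν₂ (p₂ y)) - μ‖ₑ ^ 2 =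
      ‖ν₁ (p₁ y) - p₁ μ‖ₑ ^ 2 + ‖ν₂ (p₂ y) - p₂ μ‖ₑ ^ 2 := by
    intro y
    simp_rw [← ofReal_norm, ← ENNReal.ofReal_pow (norm_nonneg _), norm_append_sub_sq]
    rw [ENNReal.ofReal_add (by positivity) (by positivity)]
  simp_rw [hpt]
  rw [lintegral_add_left (by fun_prop)]
  refine add_le_add ?_ ?_
  · rw [← lintegral_map (f := fun y => ‖ν₁ y - p₁ μ‖ₑ ^ 2) (by fun_prop) hp₁,
      observationLaw_map_precomp μ (Fin.castAdd_injective m n)]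
    exact h₁ _ hμ.1
  · rw [← lintegral_map (f := fun y => ‖ν₂ y - p₂ μ‖ₑ ^ 2) (by fun_prop) hp₂,
      observationLaw_map_precomp μ (Fin.natAdd_injective n m)]
    exact h₂ _ hμ.2

theorem criticalRadius_mono {H H' : ℝ≥0 → EReal} (h : ∀ ε, H ε ≤ H' ε) :
    criticalRadius σ H ≤ criticalRadius σ H' :=
  sSup_le_sSup fun _ ⟨ε, hr, hε⟩ => ⟨ε, hr, hε.trans (h ε)⟩

end GaussianSequence

/-! ### The two-sided bound -/

open GaussianSequence in
theorem mainTheorem10 :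
    ∃ c₀ : ℝ≥0, 0 < c₀ ∧ ∀ c : ℝ≥0, c₀ ≤ c →
      ∃ a A : ℝ≥0, 0 < a ∧ 0 < A ∧
        ∀ (m n : ℕ) (K₁ : Set (EuclideanSpace ℝ (Fin m))) (K₂ : Set (EuclideanSpace ℝ (Fin n)))
          (σ : ℝ),
          IsClosed K₁ → Bornology.IsBounded K₁ → Convex ℝ K₁ →
          IsClosed K₂ → Bornology.IsBounded K₂ → Convex ℝ K₂ →
          0 < σ →
          (a : ℝ≥0∞) *
              min (GaussianSequence.criticalRadius σ (fun ε =>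
                    max (GaussianSequence.localEntropy c K₁ ε)
                      (GaussianSequence.localEntropy c K₂ ε)) ^ 2)
                (Metric.ediam (GaussianSequence.cartesianProduct K₁ K₂) ^ 2)
            ≤ GaussianSequence.minimaxRisk σ (GaussianSequence.cartesianProduct K₁ K₂) ∧
          GaussianSequence.minimaxRisk σ (GaussianSequence.cartesianProduct K₁ K₂)
            ≤ (A : ℝ≥0∞) *
              min (GaussianSequence.criticalRadius σ (fun ε =>
                    max (GaussianSequence.localEntropy c K₁ ε)
                      (GaussianSequence.localEntropy c K₂ ε)) ^ 2)
                (Metric.ediam (GaussianSequence.cartesianProduct K₁ K₂) ^ 2) := by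
  refine ⟨16, by norm_num, fun c hc => ?_⟩
  have hc0 : 0 < c := lt_of_lt_of_le (by norm_num) hc
  refine ⟨1 / (128 * c ^ 2), 2 * (4 * (2 * c ^ 2 + 32770)), by positivity, by positivity, ?_⟩
  intro m n K₁ K₂ σ _ hb₁ hK₁ _ hb₂ hK₂ hσ
  set r := criticalRadius σ fun ε => max (localEntropy c K₁ ε) (localEntropy c K₂ ε)
  set K := cartesianProduct K₁ K₂
  by_cases hne : K₁.Nonempty ∧ K₂.Nonempty
  swap
  · have hK : K = ∅ := by
      refine Set.eq_empty_of_forall_notMem fun x hx => hne ⟨⟨_, hx.1⟩, ⟨_, hx.2⟩⟩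
    have hrisk : minimaxRisk σ K = 0 := by
      refine le_antisymm (iInf₂_le_of_le id measurable_id ?_) zero_le
      simp [hK]
    rw [hrisk, hK]
    simp
  obtain ⟨hne₁, hne₂⟩ := hne
  obtain ⟨z₁, hz₁⟩ := id hne₁
  obtain ⟨z₂, hz₂⟩ := id hne₂
  have hmaps₁ : Set.MapsTo (fun u => append u z₂) K₁ K :=
    fun u hu => append_mem_cartesianProduct hu hz₂
  have hmaps₂ : Set.MapsTo (fun v => append z₁ v) K₂ K :=
    fun v hv => append_mem_cartesianProduct hz₁ hv
  constructor
  · set R := minimaxRisk σ K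
    have hε : ∀ ε : ℝ≥0, (((ε : ℝ) ^ 2 / σ ^ 2 : ℝ) : EReal) ≤
        max (localEntropy c K₁ ε) (localEntropy c K₂ ε) →
        ((1 / (128 * c ^ 2) * ε ^ 2 : ℝ≥0) : ℝ≥0∞) ≤ R := by
      intro ε h
      have h1 : ENNReal.ofReal (((ε : ℝ) / c) ^ 2 / 128) ≤ R := by
        rcases le_max_iff.1 h with h | h
        · exact le_minimaxRisk_of_le_localEntropy hσ hK₁ (isometry_append_left z₂) hmaps₁ c h
        · exact le_minimaxRisk_of_le_localEntropy hσ hK₂ (isometry_append_right z₁) hmaps₂ c h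
      have h2 : ((ε : ℝ) / c) ^ 2 / 128 = ((1 / (128 * c ^ 2) * ε ^ 2 : ℝ≥0) : ℝ) := by
        push_cast
        field_simp
      rwa [h2, ENNReal.ofReal_coe_nnreal] at h1
    have ha : ((1 / (128 * c ^ 2) : ℝ≥0) : ℝ≥0∞) ≠ 0 := by
      exact_mod_cast (by positivity : 1 / (128 * c ^ 2) ≠ 0)
    -- A square root of `R/a`, with `a` the lower constant, bounds every admissible `ε` and hence
    -- their supremum, so no near-maximiser has to be chosen.
    obtain ⟨q, hq⟩ : ∃ q : ℝ≥0∞, q ^ 2 = R / ((1 / (128 * c ^ 2) : ℝ≥0) : ℝ≥0∞) :=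
      ⟨_, ENNReal.rpow_inv_natCast_pow two_ne_zero _⟩
    have hrq : r ≤ q := by
      refine sSup_le ?_
      rintro _ ⟨ε, rfl, h⟩
      refine (ENNReal.pow_right_strictMono two_ne_zero).le_iff_le.1 ?_
      rw [hq, ENNReal.le_div_iff_mul_le (Or.inl ha) (Or.inl ENNReal.coe_ne_top), mul_comm]
      exact_mod_cast hε ε h
    calc _ ≤ ((1 / (128 * c ^ 2) : ℝ≥0) : ℝ≥0∞) * q ^ 2 := by
          gcongr
          exact (min_le_left _ _).trans (by gcongr)
      _ ≤ R := by
          rw [hq]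
          exact ENNReal.mul_div_le
  · obtain ⟨ν₁, hν₁, h₁⟩ := exists_estimator_le_criticalRadius hσ hne₁ hb₁ hK₁ hc
    obtain ⟨ν₂, hν₂, h₂⟩ := exists_estimator_le_criticalRadius hσ hne₂ hb₂ hK₂ hc
    refine (minimaxRisk_cartesianProduct_le hν₁ hν₂ h₁ h₂).trans ?_
    have hr₁ : criticalRadius σ (localEntropy c K₁) ≤ r :=
      criticalRadius_mono fun ε => le_max_left _ _
    have hr₂ : criticalRadius σ (localEntropy c K₂) ≤ r :=
      criticalRadius_mono fun ε => le_max_right _ _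
    have hd₁ : Metric.ediam K₁ ≤ Metric.ediam K :=
      ediam_le_of_isometry_mapsTo (isometry_append_left z₂) hmaps₁
    have hd₂ : Metric.ediam K₂ ≤ Metric.ediam K :=
      ediam_le_of_isometry_mapsTo (isometry_append_right z₁) hmaps₂
    -- The factor `2` in `A` splits into one copy of the bound for each block.
    rw [ENNReal.coe_mul 2, mul_assoc, ENNReal.coe_ofNat, two_mul (_ * min _ _)]
    refine add_le_add ?_ ?_ <;> gcongr
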